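/- Let $G=(V,E)$ be a finite connected (simple, undirected, nonempty) graph and let $0<\beta<1$. For $\sigma\in\{+,-\}^V$ let $d(\sigma)$ be the number of edges $\{u,v\}\in E$ with $\sigma(u)\neq\sigma(v)$ and let $p(\sigma)$ be the number of vertices $v\in V$ with $\sigma(v)=+$. Let $$Z_I(G,\beta,\lambda)=\sum_{\sigma\in\{+,-\}^V}\beta^{d(\sigma)}\lambda^{p(\sigma)}$$ be the partition function of the ferromagnetic Ising model, regarded as a polynomial in the complex variable $\lambda$, and let $\mathcal{D}=\lambda\,\frac{\partial}{\partial\lambda}$. Then: 1. every complex zero $\lambda$ of $\mathcal{D}Z_I(G,\beta,\lambda)$ satisfies $|\lambda|<1$; 2. (Lee--Yang) every complex zero $\lambda$ of $Z_I(G,\beta,\lambda)$ satisfies $|\lambda|=1$; 3. consequently $Z_I$ and $\mathcal{D}Z_I$ have no common complex zeros, and 4. all complex zeros of $Z_I$ are simple. -/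

import Mathlib

open Polynomial

noncomputable section

namespace Ising

variable {V : Type*} [Fintype V] [DecidableEq V]

/-- The number of disagreements `d(σ)`: the number of edges `{u, v}` of `G` with `σ u ≠ σ v`.
A spin configuration is a function `σ : V → Bool`, where `true` is the spin `+`
and `false` is the spin `-`. -/
def disagreements (G : SimpleGraph V) [DecidableRel G.Adj] (σ : V → Bool) : ℕ :=
  (G.edgeFinset.filter fun e => ¬ (e.map σ).IsDiag).card

/-- The magnetization `p(σ)`: the number of vertices with spin `+`. -/
def plusCount (σ : V → Bool) : ℕ :=
  (Finset.univ.filter fun v => σ v = true).card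

/-- The partition function `Z_I(G, β, λ) = ∑_σ β ^ d(σ) * λ ^ p(σ)` of the ferromagnetic Ising
model, as a polynomial in the vertex activity `λ` (the variable `X`) with complex coefficients. -/
def partitionFunction (G : SimpleGraph V) [DecidableRel G.Adj] (β : ℝ) : ℂ[X] :=
  ∑ σ : V → Bool, C ((β : ℂ) ^ disagreements G σ) * X ^ plusCount σ

/-- The differential operator `λ ∂/∂λ` on polynomials in `λ`. -/
def eulerD (P : ℂ[X]) : ℂ[X] := X * derivative P

end Ising

end

/-! Condition on the spin of one vertex `v`: `Z = A + z_v B`, where `A` and `B` are partition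
functions on the remaining vertices. Conjugation and spin flip give `|A| = |B|` on the torus, and
the maximum principle, one variable at a time, gives `|B| ≤ |A|` on the polydisc. So `Z ≠ 0` once
`|z_v| < 1` and `A ≠ 0`, and inversion of the activity turns this into Lee–Yang.

For simplicity take all activities equal and write `Z = A + f`, with `f` the part where `v` is `+`.
Then `A` is the reflection `z^n f(1/z)`, and connectedness forces all `n` zeros of `f` into the open
disc. At a zero of `Z`, `z Z' = f (2 Re(z f'/f) - n)`, and `Re(z f'/f) > n/2` on the unit circle, so
the zero is simple. Where `|z| ≥ 1` and `Z(z) ≠ 0`, the same root count gives `Re(z Z'/Z) ≥ n/2 >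
0`. -/

namespace Ising

/-- The homogeneous two-field partition function on the vertex set `S` with pair weights `b`:
a vertex in state `+` carries the weight `x`, a vertex in state `-` the weight `y`. -/
def pairSum {V R : Type*} [DecidableEq V] [CommRing R] (b : V → V → R) (S : Finset V)
    (x y : V → R) : R :=
  ∑ T ∈ S.powerset, (∏ i ∈ T, x i) * (∏ i ∈ S \ T, y i) * ∏ i ∈ T, ∏ j ∈ S \ T, b i j

/-! ### Algebra of the two-field partition function -/

section Algebra

variable {V R : Type*} [DecidableEq V] [CommRing R]

theorem pairSum_empty (b : V → V → R) (x y : V → R) : pairSum b ∅ x y = 1 := by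
  simp [pairSum]

theorem map_pairSum {R' : Type*} [CommRing R'] (φ : R →+* R') (b : V → V → R) (S : Finset V)
    (x y : V → R) :
    φ (pairSum b S x y) =
      pairSum (fun i j => φ (b i j)) S (fun i => φ (x i)) (fun i => φ (y i)) := by
  simp [pairSum, map_sum, map_prod]

theorem pairSum_congr (b : V → V → R) {S : Finset V} {x x' y y' : V → R}
    (hx : ∀ i ∈ S, x i = x' i) (hy : ∀ i ∈ S, y i = y' i) :
    pairSum b S x y = pairSum b S x' y' := by
  refine Finset.sum_congr rfl fun T hT => ?_
  rw [Finset.prod_congr rfl fun i hi => hx i (Finset.mem_powerset.1 hT hi),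
    Finset.prod_congr (s₁ := S \ T) rfl fun i hi => hy i (Finset.mem_sdiff.1 hi).1]

theorem pairSum_swap {b : V → V → R} (hb : ∀ i j, b i j = b j i) (S : Finset V) (x y : V → R) :
    pairSum b S x y = pairSum b S y x := by
  refine Finset.sum_nbij' (fun T => S \ T) (fun T => S \ T) ?_ ?_ ?_ ?_ ?_
  · intro T _; simp
  · intro T _; simp
  · intro T hT; simpa using Finset.mem_powerset.1 hT
  · intro T hT; simpa using Finset.mem_powerset.1 hT
  · intro T hT
    have h : S \ (S \ T) = T := by simpa using Finset.mem_powerset.1 hT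
    rw [h, Finset.prod_comm (s := S \ T)]
    simp only [hb]
    ring_nf

/-- Conditioning on the spin at `v`: its couplings are absorbed into the weights of the opposite
spin. -/
theorem pairSum_insert {b : V → V → R} {S : Finset V} {v : V} (hv : v ∉ S) (x y : V → R) :
    pairSum b (insert v S) x y =
      y v * pairSum b S (fun i => x i * b i v) y +
        x v * pairSum b S x (fun j => y j * b v j) := by
  rw [pairSum, Finset.sum_powerset_insert hv, pairSum, pairSum, Finset.mul_sum, Finset.mul_sum]
  congr 1
  · refine Finset.sum_congr rfl fun T hT => ?_
    have hvT : v ∉ T := fun h => hv (Finset.mem_powerset.1 hT h)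
    have h1 : insert v S \ T = insert v (S \ T) := Finset.insert_sdiff_of_notMem _ hvT
    have h2 : v ∉ S \ T := fun h => hv (Finset.mem_sdiff.1 h).1
    rw [h1, Finset.prod_insert h2]
    simp only [Finset.prod_insert h2, Finset.prod_mul_distrib]
    ring
  · refine Finset.sum_congr rfl fun T hT => ?_
    have hvT : v ∉ T := fun h => hv (Finset.mem_powerset.1 hT h)
    have h1 : insert v S \ insert v T = S \ T := by
      ext i; simp only [Finset.mem_sdiff, Finset.mem_insert]
      constructor
      · tauto
      · rintro ⟨h, h'⟩; refine ⟨Or.inr h, ?_⟩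
        rintro (rfl | h3)
        · exact hv h
        · exact h' h3
    rw [h1, Finset.prod_insert hvT, Finset.prod_insert hvT]
    simp only [Finset.prod_mul_distrib]
    ring

theorem pairSum_mul (b : V → V → R) (S : Finset V) (c x y : V → R) :
    pairSum b S (fun i => c i * x i) (fun i => c i * y i) = (∏ i ∈ S, c i) * pairSum b S x y := by
  rw [pairSum, pairSum, Finset.mul_sum]
  refine Finset.sum_congr rfl fun T hT => ?_
  rw [← Finset.prod_sdiff (Finset.mem_powerset.1 hT)]
  simp only [Finset.prod_mul_distrib]
  ring

end Algebra

/-! ### Lee–Yang nonvanishing on the polydisc -/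

section Analysis

variable {V : Type*} [DecidableEq V]

theorem differentiable_pairSum (b : V → V → ℂ) (S : Finset V) {x y : ℂ → V → ℂ}
    (hx : ∀ i, Differentiable ℂ fun w => x w i) (hy : ∀ i, Differentiable ℂ fun w => y w i) :
    Differentiable ℂ fun w => pairSum b S (x w) (y w) := by
  unfold pairSum
  fun_prop

/-- On the torus `z i * conj (z i) = 1`, so conjugating and multiplying by `∏ z i` exchanges the two
fields; a global spin flip restores their order. -/
theorem norm_pairSum_eq_of_norm_eq_one {c : V → V → ℝ} (hc : ∀ i j, c i j = c j i) (S : Finset V)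
    {z : V → ℂ} (hz : ∀ i ∈ S, ‖z i‖ = 1) (h : V → ℝ) :
    ‖pairSum (fun i j => (c i j : ℂ)) S z (fun i => (h i : ℂ))‖ =
      ‖pairSum (fun i j => (c i j : ℂ)) S (fun i => z i * h i) 1‖ := by
  have key : (∏ i ∈ S, z i) *
      (starRingEnd ℂ) (pairSum (fun i j => (c i j : ℂ)) S (fun i => z i * h i) 1) =
      pairSum (fun i j => (c i j : ℂ)) S z (fun i => (h i : ℂ)) := by
    rw [map_pairSum, ← pairSum_mul, pairSum_swap (by simp [hc])]
    simp only [Complex.conj_ofReal, map_mul]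
    refine pairSum_congr _ (by simp) fun i hi => ?_
    rw [← mul_assoc, Complex.mul_conj, Complex.normSq_eq_norm_sq, hz i hi]
    simp
  rw [← key, norm_mul, norm_prod, Finset.prod_congr rfl hz, Finset.prod_const_one, one_mul,
    Complex.norm_conj]

/-- `T` collects the coordinates already freed from the unit circle; each new one is freed by the
maximum principle for the quotient, whose denominator does not vanish. -/
theorem norm_pairSum_le_of_ne_zero {c : V → V → ℝ} (hc : ∀ i j, c i j = c j i) (S : Finset V)
    (h : V → ℝ)
    (hne : ∀ z : V → ℂ, (∀ i ∈ S, ‖z i‖ ≤ 1) →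
      pairSum (fun i j => (c i j : ℂ)) S (fun i => z i * h i) 1 ≠ 0)
    (T : Finset V) : T ⊆ S → ∀ z : V → ℂ, (∀ i ∈ S, ‖z i‖ ≤ 1) → (∀ i ∈ S, i ∉ T → ‖z i‖ = 1) →
      ‖pairSum (fun i j => (c i j : ℂ)) S z (fun i => (h i : ℂ))‖ ≤
        ‖pairSum (fun i j => (c i j : ℂ)) S (fun i => z i * h i) 1‖ := by
  induction T using Finset.induction_on with
  | empty =>
    intro _ z _ hz
    exact (norm_pairSum_eq_of_norm_eq_one hc S (fun i hi => hz i hi (by simp)) h).le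
  | insert j T hj ih =>
    intro hTS z hz1 hz
    have hle : ∀ w : ℂ, ‖w‖ ≤ 1 → ∀ i ∈ S, ‖Function.update z j w i‖ ≤ 1 := by
      intro w hw i hi
      by_cases hij : i = j
      · subst hij; simpa using hw
      · simpa [hij] using hz1 i hi
    have hupd : ∀ i, Differentiable ℂ fun w : ℂ => Function.update z j w i := by
      intro i
      by_cases hij : i = j
      · subst hij; simp
      · simp [hij]
    set g : ℂ → ℂ := fun w =>
      pairSum (fun i j => (c i j : ℂ)) S (Function.update z j w) (fun i => (h i : ℂ)) /
        pairSum (fun i j => (c i j : ℂ)) S (fun i => Function.update z j w i * h i) 1 with hg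
    have hd : DiffContOnCl ℂ g (Metric.ball 0 1) := by
      apply DifferentiableOn.diffContOnCl
      rw [closure_ball _ one_ne_zero]
      refine DifferentiableOn.div
        (differentiable_pairSum _ _ hupd fun i => by fun_prop).differentiableOn
        (differentiable_pairSum _ _ (fun i => (hupd i).mul_const _)
          fun i => by fun_prop).differentiableOn fun w hw => ?_
      exact hne _ (hle w (by simpa using hw))
    have hb : ∀ w ∈ frontier (Metric.ball (0 : ℂ) 1), ‖g w‖ ≤ 1 := by
      intro w hw
      rw [frontier_ball _ one_ne_zero, mem_sphere_zero_iff_norm] at hw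
      rw [hg]
      simp only [norm_div]
      refine div_le_one_of_le₀ ?_ (norm_nonneg _)
      refine ih (fun i hi => hTS (Finset.mem_insert_of_mem hi)) _ (hle w hw.le) fun i hi hiT => ?_
      by_cases hij : i = j
      · subst hij; simpa using hw
      · simpa [hij] using hz i hi (by simp [hij, hiT])
    have hjS : j ∈ S := hTS (Finset.mem_insert_self _ _)
    have := Complex.norm_le_of_forall_mem_frontier_norm_le Metric.isBounded_ball hd hb
      (z := z j) (by rw [closure_ball _ one_ne_zero]; simpa using hz1 j hjS)
    simp only [hg, Function.update_eq_self, norm_div] at this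
    rwa [div_le_one (norm_pos_iff.2 (hne z hz1))] at this

/-- Strict couplings push every `z i * c i v` into the open disc, where `hS` supplies the
nonvanishing that the maximum principle needs. -/
theorem norm_pairSum_le_of_lt_one {c : V → V → ℝ} (hc : ∀ i j, c i j = c j i)
    (h0 : ∀ i j, 0 ≤ c i j) (h1 : ∀ i j, c i j < 1) (S : Finset V) {v : V}
    (hS : ∀ z : V → ℂ, (∀ i ∈ S, ‖z i‖ ≤ 1) → (∃ i ∈ S, ‖z i‖ < 1) →
      pairSum (fun i j => (c i j : ℂ)) S z 1 ≠ 0)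
    {z : V → ℂ} (hz : ∀ i ∈ S, ‖z i‖ ≤ 1) :
    pairSum (fun i j => (c i j : ℂ)) S (fun i => z i * c i v) 1 ≠ 0 ∧
    ‖pairSum (fun i j => (c i j : ℂ)) S z (fun i => (c i v : ℂ))‖ ≤
      ‖pairSum (fun i j => (c i j : ℂ)) S (fun i => z i * c i v) 1‖ := by
  have hne : ∀ z : V → ℂ, (∀ i ∈ S, ‖z i‖ ≤ 1) →
      pairSum (fun i j => (c i j : ℂ)) S (fun i => z i * c i v) 1 ≠ 0 := by
    intro z hz
    rcases S.eq_empty_or_nonempty with rfl | ⟨u, hu⟩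
    · simp [pairSum_empty]
    · have hlt : ∀ i ∈ S, ‖z i * (c i v : ℂ)‖ < 1 := by
        intro i hi
        rw [norm_mul, Complex.norm_real, Real.norm_of_nonneg (h0 _ _)]
        exact (mul_le_of_le_one_left (h0 _ _) (hz i hi)).trans_lt (h1 _ _)
      exact hS _ (fun i hi => (hlt i hi).le) ⟨u, hu, hlt u hu⟩
  exact ⟨hne z hz, norm_pairSum_le_of_ne_zero hc S (fun i => c i v) hne S subset_rfl z hz
    fun i hi hi' => absurd hi hi'⟩

theorem add_mul_ne_zero_of_norm_le {A B w : ℂ} (hA : A ≠ 0) (hBA : ‖B‖ ≤ ‖A‖) (hw : ‖w‖ < 1) :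
    A + w * B ≠ 0 := by
  intro h
  have h1 : ‖A‖ = ‖w‖ * ‖B‖ := by
    rw [← norm_mul, ← norm_neg (w * B), eq_neg_of_add_eq_zero_left h]
  have h2 : 0 < ‖A‖ := norm_pos_iff.2 hA
  nlinarith [norm_nonneg w, norm_nonneg B]

theorem pairSum_ne_zero_of_lt_one {c : V → V → ℝ} (hc : ∀ i j, c i j = c j i)
    (h0 : ∀ i j, 0 ≤ c i j) (h1 : ∀ i j, c i j < 1) (S : Finset V) :
    ∀ z : V → ℂ, (∀ i ∈ S, ‖z i‖ ≤ 1) → (∃ i ∈ S, ‖z i‖ < 1) →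
      pairSum (fun i j => (c i j : ℂ)) S z 1 ≠ 0 := by
  induction S using Finset.strongInduction with
  | H S ih =>
    rintro z hz ⟨v, hv, hzv⟩
    obtain ⟨hA, hBA⟩ := norm_pairSum_le_of_lt_one hc h0 h1 (S.erase v) (v := v)
      (ih _ (Finset.erase_ssubset hv)) fun i hi => hz i (Finset.mem_of_mem_erase hi)
    rw [← Finset.insert_erase hv, pairSum_insert (Finset.notMem_erase v S)]
    simp only [Pi.one_apply, one_mul, hc v]
    exact add_mul_ne_zero_of_norm_le hA hBA hzv

/-- Scaling the couplings by `t < 1` makes them strict. Unlike nonvanishing, the weak inequality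
survives the limit `t → 1`. -/
theorem norm_pairSum_le {c : V → V → ℝ} (hc : ∀ i j, c i j = c j i)
    (h0 : ∀ i j, 0 ≤ c i j) (h1 : ∀ i j, c i j ≤ 1) (S : Finset V) (v : V)
    {z : V → ℂ} (hz : ∀ i ∈ S, ‖z i‖ ≤ 1) :
    ‖pairSum (fun i j => (c i j : ℂ)) S z (fun i => (c i v : ℂ))‖ ≤
      ‖pairSum (fun i j => (c i j : ℂ)) S (fun i => z i * c i v) 1‖ := by
  have hf : Continuous fun t : ℝ =>
      ‖pairSum (fun i j => ((t * c i j : ℝ) : ℂ)) S z (fun i => ((t * c i v : ℝ) : ℂ))‖ := by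
    unfold pairSum; fun_prop
  have hg : Continuous fun t : ℝ =>
      ‖pairSum (fun i j => ((t * c i j : ℝ) : ℂ)) S (fun i => z i * ((t * c i v : ℝ) : ℂ)) 1‖ := by
    unfold pairSum; fun_prop
  have key : ∀ t ∈ Set.Ico (0 : ℝ) 1,
      ‖pairSum (fun i j => ((t * c i j : ℝ) : ℂ)) S z (fun i => ((t * c i v : ℝ) : ℂ))‖ ≤
      ‖pairSum (fun i j => ((t * c i j : ℝ) : ℂ)) S (fun i => z i * ((t * c i v : ℝ) : ℂ)) 1‖ := by
    intro t ht
    have hc' : ∀ i j, t * c i j = t * c j i := fun i j => by rw [hc]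
    have h0' : ∀ i j, 0 ≤ t * c i j := fun i j => mul_nonneg ht.1 (h0 i j)
    have h1' : ∀ i j, t * c i j < 1 := fun i j =>
      (mul_le_of_le_one_right ht.1 (h1 i j)).trans_lt ht.2
    exact (norm_pairSum_le_of_lt_one (c := fun i j => t * c i j) hc' h0' h1' S
      (pairSum_ne_zero_of_lt_one (c := fun i j => t * c i j) hc' h0' h1' S) hz).2
  have hcl := (isClosed_le hf hg).closure_subset_iff.2 key
  rw [closure_Ico zero_ne_one] at hcl
  simpa using hcl (Set.right_mem_Icc.2 zero_le_one)

/-- Lee–Yang nonvanishing on the closed unit polydisc, with the boundary points allowed as long as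
no set of vertices is cut off from both the interactions and the strict activities. -/
theorem pairSum_ne_zero {c : V → V → ℝ} (hc : ∀ i j, c i j = c j i)
    (h0 : ∀ i j, 0 ≤ c i j) (h1 : ∀ i j, c i j ≤ 1) (S : Finset V) :
    ∀ z : V → ℂ, (∀ i ∈ S, ‖z i‖ ≤ 1) →
      (∀ U ⊆ S, U.Nonempty → (∃ u ∈ U, ‖z u‖ < 1) ∨ ∃ u ∈ U, ∃ w ∈ S \ U, c u w < 1) →
      pairSum (fun i j => (c i j : ℂ)) S z 1 ≠ 0 := by
  induction S using Finset.strongInduction with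
  | H S ih =>
    intro z hz hU
    rcases S.eq_empty_or_nonempty with rfl | hne
    · simp [pairSum_empty]
    -- For `U = S` no coupling leaves `U`, so some activity is strict.
    obtain ⟨v, hv, hzv⟩ : ∃ u ∈ S, ‖z u‖ < 1 := by
      rcases hU S subset_rfl hne with h | ⟨u, hu, w, hw, _⟩
      · exact h
      · simp at hw
    have hz' : ∀ i ∈ S.erase v, ‖z i‖ ≤ 1 := fun i hi => hz i (Finset.mem_of_mem_erase hi)
    have hn : ∀ i, ‖z i * (c i v : ℂ)‖ = ‖z i‖ * c i v := fun i => by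
      rw [norm_mul, Complex.norm_real, Real.norm_of_nonneg (h0 _ _)]
    have hA : pairSum (fun i j => (c i j : ℂ)) (S.erase v) (fun i => z i * c i v) 1 ≠ 0 := by
      refine ih _ (Finset.erase_ssubset hv) _ (fun i hi => ?_) fun U hUS hUne => ?_
      · rw [hn]; exact mul_le_one₀ (hz' i hi) (h0 _ _) (h1 _ _)
      · rcases hU U (hUS.trans (Finset.erase_subset _ _)) hUne with ⟨u, hu, hlt⟩ | ⟨u, hu, w, hw, hlt⟩
        · refine Or.inl ⟨u, hu, ?_⟩
          rw [hn]; exact (mul_le_of_le_one_right (norm_nonneg _) (h1 _ _)).trans_lt hlt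
        -- A strict coupling to the deleted vertex reappears as a strict activity at `u`.
        · by_cases hwv : w = v
          · subst hwv
            refine Or.inl ⟨u, hu, ?_⟩
            rw [hn]; exact (mul_le_of_le_one_left (h0 _ _) (hz' u (hUS hu))).trans_lt hlt
          · refine Or.inr ⟨u, hu, w, ?_, hlt⟩
            simp only [Finset.mem_sdiff, Finset.mem_erase] at hw ⊢
            exact ⟨⟨hwv, hw.1⟩, hw.2⟩
    rw [← Finset.insert_erase hv, pairSum_insert (Finset.notMem_erase v S)]
    simp only [Pi.one_apply, one_mul, hc v]
    exact add_mul_ne_zero_of_norm_le hA (norm_pairSum_le hc h0 h1 _ v hz') hzv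

end Analysis

end Ising

namespace Ising

/-! ### Logarithmic derivatives and reflected polynomials -/

section Polynomial

/-- `2 Re(z/(z-ζ)) - 1 = (|z|² - |ζ|²)/|z-ζ|²`. -/
theorem half_le_re_div_sub {z ζ : ℂ} (hne : z - ζ ≠ 0) (h : ‖ζ‖ ≤ ‖z‖) :
    1 / 2 ≤ (z / (z - ζ)).re := by
  have h1 : Complex.normSq ζ ≤ Complex.normSq z := by
    rw [Complex.normSq_eq_norm_sq, Complex.normSq_eq_norm_sq]; gcongr
  rw [Complex.div_re, ← add_div, le_div_iff₀ (Complex.normSq_pos.2 hne)]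
  simp only [Complex.normSq_apply, Complex.sub_re, Complex.sub_im] at h1 ⊢
  linarith

theorem half_lt_re_div_sub {z ζ : ℂ} (h : ‖ζ‖ < ‖z‖) : 1 / 2 < (z / (z - ζ)).re := by
  have hne : z - ζ ≠ 0 := fun h' => by rw [sub_eq_zero.1 h'] at h; exact lt_irrefl _ h
  have h1 : Complex.normSq ζ < Complex.normSq z := by
    rw [Complex.normSq_eq_norm_sq, Complex.normSq_eq_norm_sq]; gcongr
  rw [Complex.div_re, ← add_div, lt_div_iff₀ (Complex.normSq_pos.2 hne)]
  simp only [Complex.normSq_apply, Complex.sub_re, Complex.sub_im] at h1 ⊢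
  linarith

theorem re_logDeriv_eq {P : ℂ[X]} {z : ℂ} (hz : P.eval z ≠ 0) :
    (z * P.derivative.eval z / P.eval z).re =
      (P.roots.map fun ζ => (z / (z - ζ)).re).sum := by
  rw [mul_div_assoc, (IsAlgClosed.splits P).eval_derivative_div_eval_of_ne_zero hz,
    ← Multiset.sum_map_mul_left, ← Complex.reLm_coe, map_multiset_sum, Multiset.map_map]
  simp [div_eq_mul_inv]

theorem le_re_logDeriv {P : ℂ[X]} {z : ℂ} (hz : P.eval z ≠ 0)
    (hP : ∀ ζ, P.eval ζ = 0 → ‖ζ‖ ≤ ‖z‖) :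
    (P.natDegree : ℝ) / 2 ≤ (z * P.derivative.eval z / P.eval z).re := by
  rw [re_logDeriv_eq hz, (IsAlgClosed.splits P).natDegree_eq_card_roots]
  have := Multiset.card_nsmul_le_sum (s := P.roots.map fun ζ => (z / (z - ζ)).re) (a := 1 / 2) (by
    simp only [Multiset.mem_map]
    rintro _ ⟨ζ, hζ, rfl⟩
    have h0 : P.eval ζ = 0 := (mem_roots'.1 hζ).2
    refine half_le_re_div_sub (fun h => hz ?_) (hP ζ h0)
    rwa [sub_eq_zero.1 h])
  simpa [div_eq_mul_inv] using this

theorem lt_re_logDeriv {P : ℂ[X]} {z : ℂ} (hdeg : 0 < P.natDegree)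
    (hP : ∀ ζ, P.eval ζ = 0 → ‖ζ‖ < ‖z‖) :
    (P.natDegree : ℝ) / 2 < (z * P.derivative.eval z / P.eval z).re := by
  have hz : P.eval z ≠ 0 := fun h => lt_irrefl _ (hP z h)
  rw [re_logDeriv_eq hz]
  rw [(IsAlgClosed.splits P).natDegree_eq_card_roots] at hdeg ⊢
  have := Multiset.sum_lt_sum_of_nonempty (s := P.roots) (f := fun _ => (1 / 2 : ℝ))
    (g := fun ζ => (z / (z - ζ)).re) (Multiset.card_pos.1 hdeg)
    fun ζ hζ => half_lt_re_div_sub (hP ζ (mem_roots'.1 hζ).2)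
  simpa [div_eq_mul_inv] using this

theorem eval_inv_eq_conj {f : ℂ[X]} (hf : f.map (starRingEnd ℂ) = f) {z : ℂ} (hz : ‖z‖ = 1) :
    f.eval z⁻¹ = (starRingEnd ℂ) (f.eval z) := by
  rw [Complex.inv_eq_conj hz]
  conv_lhs => rw [← hf]
  rw [eval_map, eval₂_at_apply]

/-- With `L = z f'/f`, differentiating the reflection on the circle gives `z A' = A (n - conj L)`;
then substitute `A = -f`. -/
theorem eulerD_add_reflect {f A : ℂ[X]} {n : ℕ} (hf : f.map (starRingEnd ℂ) = f)
    (hA : ∀ w ≠ 0, A.eval w = w ^ n * f.eval w⁻¹) {z : ℂ} (hz : ‖z‖ = 1)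
    (hfz : f.eval z ≠ 0) (h0 : A.eval z + f.eval z = 0) :
    z * (A.derivative.eval z + f.derivative.eval z) =
      f.eval z * ((-n + 2 * (z * f.derivative.eval z / f.eval z).re : ℝ) : ℂ) := by
  have hz0 : z ≠ 0 := by rintro rfl; simp at hz
  have hd : A.derivative.eval z =
      n * z ^ (n - 1) * f.eval z⁻¹ + z ^ n * (f.derivative.eval z⁻¹ * -(z ^ 2)⁻¹) := by
    have h1 : HasDerivAt (fun w => w ^ n * f.eval w⁻¹) _ z :=
      (hasDerivAt_pow n z).mul ((f.hasDerivAt z⁻¹).comp z (hasDerivAt_inv hz0))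
    refine (A.hasDerivAt z).unique (h1.congr_of_eventuallyEq ?_)
    filter_upwards [isOpen_ne.mem_nhds hz0] with w hw using hA w hw
  have hAz := hA z hz0
  have hpow : (n : ℂ) * z ^ (n - 1) * z = n * z ^ n := by
    rcases n with _ | n
    · simp
    · simp [pow_succ, mul_assoc]
  set L := z * f.derivative.eval z / f.eval z with hL
  have hLf : z * f.derivative.eval z = f.eval z * L := by rw [hL]; field_simp
  have h2 : z⁻¹ * f.derivative.eval z⁻¹ = f.eval z⁻¹ * (starRingEnd ℂ) L := by
    rw [eval_inv_eq_conj hf hz, eval_inv_eq_conj (by rw [← derivative_map, hf]) hz,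
      Complex.inv_eq_conj hz, ← map_mul, ← map_mul, hLf]
  have h3 : z * (z ^ 2)⁻¹ = z⁻¹ := by field_simp
  have h4 : (((-n + 2 * L.re : ℝ)) : ℂ) = -n + (L + (starRingEnd ℂ) L) := by
    rw [Complex.add_conj]; push_cast; ring
  rw [h4, mul_add, hLf, hd]
  have h5 : z ^ n * f.eval z⁻¹ = - f.eval z := by rw [← hAz]; exact eq_neg_of_add_eq_zero_left h0
  linear_combination (f.eval z⁻¹) * hpow - z ^ n * f.derivative.eval z⁻¹ * h3 - z ^ n * h2 +
    (n - (starRingEnd ℂ) L) * h5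

variable {V : Type*} [DecidableEq V]

theorem pairSum_X_monic_natDegree (c : V → V → ℂ) (S : Finset V) (h : V → ℂ) :
    (pairSum (fun i j => C (c i j)) S (fun _ => X) (fun i => C (h i))).Monic ∧
    (pairSum (fun i j => C (c i j)) S (fun _ => X) (fun i => C (h i))).natDegree = S.card := by
  have hform : pairSum (fun i j => C (c i j)) S (fun _ => X) (fun i => C (h i)) =
      ∑ T ∈ S.powerset, C ((∏ i ∈ S \ T, h i) * ∏ i ∈ T, ∏ j ∈ S \ T, c i j) * X ^ T.card := by
    refine Finset.sum_congr rfl fun T _ => ?_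
    simp only [Finset.prod_const, map_mul, map_prod]
    ring
  have hle : (pairSum (fun i j => C (c i j)) S (fun _ => X)
      (fun i => C (h i))).natDegree ≤ S.card := by
    rw [hform]
    refine natDegree_sum_le_of_forall_le _ _ fun T hT => ?_
    exact (natDegree_C_mul_X_pow_le _ _).trans (Finset.card_le_card (Finset.mem_powerset.1 hT))
  have hco : (pairSum (fun i j => C (c i j)) S (fun _ => X)
      (fun i => C (h i))).coeff S.card = 1 := by
    rw [hform, finsetSum_coeff, Finset.sum_eq_single S]
    · simp
    · intro T hT hTS
      rw [coeff_C_mul_X_pow, if_neg]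
      exact fun h => hTS (Finset.eq_of_subset_of_card_le (Finset.mem_powerset.1 hT) h.le)
    · simp
  exact ⟨monic_of_natDegree_le_of_coeff_eq_one _ hle hco,
    le_antisymm hle (le_natDegree_of_ne_zero (by rw [hco]; exact one_ne_zero))⟩

theorem pairSum_const_inv {c : V → V → ℂ} (hc : ∀ i j, c i j = c j i) (S : Finset V)
    {z : ℂ} (hz : z ≠ 0) (h : V → ℂ) :
    pairSum c S (fun _ => z) h = z ^ S.card * pairSum c S (fun i => z⁻¹ * h i) 1 := by
  rw [pairSum_swap hc, ← Finset.prod_const, ← pairSum_mul]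
  exact pairSum_congr _ (fun i _ => by field_simp) (by simp)

end Polynomial

/-! ### The Ising model on a connected graph -/

section Graph

/-- The pair weight of the Ising model: `β` across an edge and `1` otherwise. -/
def coupling {V : Type*} (G : SimpleGraph V) [DecidableRel G.Adj] (β : ℝ) (i j : V) : ℝ :=
  if G.Adj i j then β else 1

theorem coupling_comm {V : Type*} (G : SimpleGraph V) [DecidableRel G.Adj] (β : ℝ) (i j : V) :
    coupling G β i j = coupling G β j i := by
  simp [coupling, G.adj_comm]

theorem coupling_nonneg {V : Type*} {G : SimpleGraph V} [DecidableRel G.Adj] {β : ℝ}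
    (hβ0 : 0 ≤ β) (i j : V) : 0 ≤ coupling G β i j := by
  unfold coupling; split_ifs <;> simp [hβ0]

theorem coupling_le_one {V : Type*} {G : SimpleGraph V} [DecidableRel G.Adj] {β : ℝ}
    (hβ1 : β ≤ 1) (i j : V) : coupling G β i j ≤ 1 := by
  unfold coupling; split_ifs <;> simp [hβ1]

theorem exists_adj_of_connected {V : Type*} {G : SimpleGraph V} (hG : G.Connected) {U : Finset V}
    (hU : U.Nonempty) {v : V}
    (hv : v ∉ U) : ∃ u ∈ U, ∃ w ∉ U, G.Adj u w := by
  obtain ⟨u, hu⟩ := hU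
  obtain ⟨p⟩ := hG.preconnected u v
  obtain ⟨d, _, h1, h2⟩ := p.exists_boundary_dart (U : Set V) hu hv
  exact ⟨d.fst, h1, d.snd, h2, d.adj⟩

variable {V : Type*} [Fintype V] [DecidableEq V]

/-- Each disagreeing edge has exactly one orientation from `+` to `-`. -/
theorem disagreements_eq_card (G : SimpleGraph V) [DecidableRel G.Adj] (σ : V → Bool) :
    disagreements G σ = (((Finset.univ.filter fun v => σ v = true) ×ˢ
      (Finset.univ \ Finset.univ.filter fun v => σ v = true)).filter
        fun p => G.Adj p.1 p.2).card := by
  symm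
  refine Finset.card_nbij (fun p => s(p.1, p.2)) ?_ ?_ ?_
  · rintro ⟨i, j⟩ h
    simp only [Finset.coe_filter, Finset.mem_product, Finset.mem_sdiff, Finset.mem_filter,
      Finset.mem_univ, true_and, Set.mem_ofPred_eq] at h
    simp [h.2, h.1.1, h.1.2]
  · rintro ⟨i, j⟩ h ⟨k, l⟩ h' heq
    simp only [Finset.coe_filter, Finset.mem_product, Finset.mem_sdiff, Finset.mem_filter,
      Finset.mem_univ, true_and, Set.mem_ofPred_eq] at h h'
    simp only [Sym2.eq_iff] at heq
    rcases heq with ⟨rfl, rfl⟩ | ⟨rfl, rfl⟩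
    · rfl
    · exact absurd h.1.1 h'.1.2
  · intro e he
    induction e using Sym2.ind with
    | _ i j =>
      simp only [Finset.coe_filter, SimpleGraph.mem_edgeFinset, SimpleGraph.mem_edgeSet,
        Sym2.map_mk, Sym2.mk_isDiag_iff, Set.mem_ofPred_eq] at he
      rcases hi : σ i <;> rcases hj : σ j <;> simp [hi, hj] at he
      · exact ⟨(j, i), by simp [hi, hj, he.symm], Sym2.eq_swap⟩
      · exact ⟨(i, j), by simp [hi, hj, he], rfl⟩

theorem partitionFunction_eq_pairSum (G : SimpleGraph V) [DecidableRel G.Adj] (β : ℝ) :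
    partitionFunction G β =
      pairSum (fun i j => C (coupling G β i j : ℂ)) Finset.univ (fun _ => X) 1 := by
  unfold partitionFunction pairSum
  refine Finset.sum_nbij' (fun σ => Finset.univ.filter fun v => σ v = true)
    (fun T v => decide (v ∈ T)) (by simp) (by simp) (fun σ _ => by ext; simp)
    (fun T _ => by ext; simp) fun σ _ => ?_
  rw [← Finset.prod_product', disagreements_eq_card, plusCount]
  simp only [coupling, Pi.one_apply, Finset.prod_const, one_pow, mul_one]
  rw [mul_comm]
  congr 1
  rw [← map_prod]
  congr 1
  simp only [apply_ite (Complex.ofReal), Complex.ofReal_one]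
  rw [Finset.prod_ite]
  simp

variable {G : SimpleGraph V} [DecidableRel G.Adj] {β : ℝ}

theorem eval_partitionFunction (z : ℂ) :
    (partitionFunction G β).eval z =
      pairSum (fun i j => (coupling G β i j : ℂ)) Finset.univ (fun _ => z) 1 := by
  rw [partitionFunction_eq_pairSum, ← coe_evalRingHom, map_pairSum]
  simp only [coe_evalRingHom, eval_C, eval_X]
  exact pairSum_congr _ (by simp) (by simp)

theorem eval_partitionFunction_ne_zero_of_norm_lt_one (hβ0 : 0 ≤ β) (hβ1 : β ≤ 1) {z : ℂ}
    (hz : ‖z‖ < 1) : (partitionFunction G β).eval z ≠ 0 := by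
  rw [eval_partitionFunction]
  exact pairSum_ne_zero (coupling_comm G β) (coupling_nonneg hβ0) (coupling_le_one hβ1) _ _
    (fun _ _ => hz.le) fun U _ ⟨u, hu⟩ => Or.inl ⟨u, hu, hz⟩

/-- **Lee–Yang theorem**. -/
theorem norm_eq_one_of_eval_partitionFunction_eq_zero (hβ0 : 0 ≤ β) (hβ1 : β ≤ 1) {z : ℂ}
    (hz : (partitionFunction G β).eval z = 0) : ‖z‖ = 1 := by
  refine le_antisymm ?_ (not_lt.1 fun h =>
    eval_partitionFunction_ne_zero_of_norm_lt_one hβ0 hβ1 h hz)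
  by_contra! h
  have hz0 : z ≠ 0 := by rintro rfl; simp at h; linarith
  have hne := eval_partitionFunction_ne_zero_of_norm_lt_one (G := G) hβ0 hβ1
    (z := z⁻¹) (by rw [norm_inv]; exact inv_lt_one_of_one_lt₀ h)
  rw [eval_partitionFunction] at hz hne
  rw [pairSum_const_inv (by simp [coupling_comm G β]) _ hz0] at hz
  simp only [Pi.one_apply, mul_one] at hz
  exact mul_ne_zero (pow_ne_zero _ hz0) hne hz

/-- The part of the partition function in which the spin at `v` is pinned to `+`. -/
noncomputable def plusPart (G : SimpleGraph V) [DecidableRel G.Adj] (β : ℝ) (v : V) : ℂ[X] :=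
  X * pairSum (fun i j => C (coupling G β i j : ℂ)) (Finset.univ.erase v) (fun _ => X)
    (fun i => C (coupling G β i v : ℂ))

/-- The part of the partition function in which the spin at `v` is pinned to `-`. -/
noncomputable def minusPart (G : SimpleGraph V) [DecidableRel G.Adj] (β : ℝ) (v : V) : ℂ[X] :=
  pairSum (fun i j => C (coupling G β i j : ℂ)) (Finset.univ.erase v)
    (fun i => X * C (coupling G β i v : ℂ)) 1

theorem partitionFunction_eq_add (v : V) :
    partitionFunction G β = minusPart G β v + plusPart G β v := by
  rw [partitionFunction_eq_pairSum, ← Finset.insert_erase (Finset.mem_univ v),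
    pairSum_insert (Finset.notMem_erase v _)]
  simp [minusPart, plusPart, coupling_comm G β v]

theorem natDegree_plusPart (v : V) : (plusPart G β v).natDegree = Fintype.card V := by
  obtain ⟨h1, h2⟩ := pairSum_X_monic_natDegree (fun i j => (coupling G β i j : ℂ))
    (Finset.univ.erase v) (fun i => (coupling G β i v : ℂ))
  rw [plusPart, natDegree_X_mul h1.ne_zero, h2, Finset.card_erase_add_one (Finset.mem_univ v),
    Finset.card_univ]

theorem map_conj_plusPart (v : V) : (plusPart G β v).map (starRingEnd ℂ) = plusPart G β v := by
  rw [plusPart, ← coe_mapRingHom, map_mul, map_pairSum]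
  simp

theorem eval_plusPart (v : V) (z : ℂ) : (plusPart G β v).eval z =
    z * pairSum (fun i j => (coupling G β i j : ℂ)) (Finset.univ.erase v) (fun _ => z)
      (fun i => (coupling G β i v : ℂ)) := by
  rw [plusPart, ← coe_evalRingHom, map_mul, map_pairSum]
  simp

theorem eval_minusPart (v : V) (z : ℂ) : (minusPart G β v).eval z =
    pairSum (fun i j => (coupling G β i j : ℂ)) (Finset.univ.erase v)
      (fun i => z * (coupling G β i v : ℂ)) 1 := by
  rw [minusPart, ← coe_evalRingHom, map_pairSum]
  simp only [coe_evalRingHom, eval_C, eval_X, eval_mul]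
  exact pairSum_congr _ (by simp) (by simp)

theorem eval_minusPart_eq (v : V) {z : ℂ} (hz : z ≠ 0) : (minusPart G β v).eval z =
    z ^ Fintype.card V * (plusPart G β v).eval z⁻¹ := by
  rw [eval_minusPart, eval_plusPart,
    pairSum_const_inv (by simp [coupling_comm G β]) _ (inv_ne_zero hz), inv_inv,
    ← Finset.card_univ, ← Finset.card_erase_add_one (Finset.mem_univ v), pow_succ, inv_pow]
  field_simp

/-- Inverting a `z` outside the open disc gives activities `z⁻¹ * c i v` in the closed disc. By
connectedness every `U` avoiding `v` has an edge leaving it: to `v`, giving a strict activity, or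
elsewhere, giving a strict coupling. -/
theorem norm_lt_one_of_eval_plusPart_eq_zero (hG : G.Connected) (hβ0 : 0 ≤ β) (hβ1 : β < 1)
    {v : V} {z : ℂ} (hz : (plusPart G β v).eval z = 0) : ‖z‖ < 1 := by
  by_contra! h
  have hz0 : z ≠ 0 := by rintro rfl; simp at h; linarith
  rw [eval_plusPart, pairSum_const_inv (by simp [coupling_comm G β]) _ hz0] at hz
  refine mul_ne_zero hz0 (mul_ne_zero (pow_ne_zero _ hz0) ?_) hz
  have hi : ‖z‖⁻¹ ≤ 1 := inv_le_one_of_one_le₀ h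
  have hn : ∀ i, ‖z⁻¹ * (coupling G β i v : ℂ)‖ ≤ coupling G β i v := fun i => by
    rw [norm_mul, norm_inv, Complex.norm_real, Real.norm_of_nonneg (coupling_nonneg hβ0 _ _)]
    exact mul_le_of_le_one_left (coupling_nonneg hβ0 _ _) hi
  refine pairSum_ne_zero (coupling_comm G β) (coupling_nonneg hβ0) (coupling_le_one hβ1.le) _ _
    (fun i _ => (hn i).trans (coupling_le_one hβ1.le _ _)) fun U hU hne => ?_
  obtain ⟨u, hu, w, hw, huw⟩ := exists_adj_of_connected hG hne
    (v := v) fun h => Finset.notMem_erase v _ (hU h)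
  have hlt : coupling G β u w < 1 := by simpa [coupling, huw] using hβ1
  by_cases hwv : w = v
  · subst hwv
    exact Or.inl ⟨u, hu, (hn u).trans_lt hlt⟩
  · exact Or.inr ⟨u, hu, w, by simp [hwv, hw], hlt⟩

theorem eval_derivative_partitionFunction_ne_zero (hG : G.Connected) (hβ0 : 0 ≤ β) (hβ1 : β < 1)
    {z : ℂ} (hz : (partitionFunction G β).eval z = 0) :
    (derivative (partitionFunction G β)).eval z ≠ 0 := by
  obtain ⟨v⟩ := hG.nonempty
  have hz1 := norm_eq_one_of_eval_partitionFunction_eq_zero hβ0 hβ1.le hz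
  have hroots : ∀ ζ, (plusPart G β v).eval ζ = 0 → ‖ζ‖ < ‖z‖ := fun ζ hζ => by
    rw [hz1]; exact norm_lt_one_of_eval_plusPart_eq_zero hG hβ0 hβ1 hζ
  have hfz : (plusPart G β v).eval z ≠ 0 := fun h => lt_irrefl _ (hroots z h)
  rw [partitionFunction_eq_add v, eval_add] at hz
  have key := eulerD_add_reflect (map_conj_plusPart v)
    (fun w hw => eval_minusPart_eq v hw) hz1 hfz hz
  have hlt := lt_re_logDeriv (by rw [natDegree_plusPart]; exact Fintype.card_pos_iff.2 ⟨v⟩) hroots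
  rw [natDegree_plusPart] at hlt
  rw [partitionFunction_eq_add v, derivative_add, eval_add]
  intro h
  rw [h, mul_zero] at key
  refine mul_ne_zero hfz ?_ key.symm
  rw [Complex.ofReal_ne_zero]
  linarith

theorem natDegree_partitionFunction :
    (partitionFunction G β).natDegree = Fintype.card V := by
  rw [partitionFunction_eq_pairSum]
  simpa [Pi.one_def] using (pairSum_X_monic_natDegree (fun i j => (coupling G β i j : ℂ))
    Finset.univ (fun _ => 1)).2

theorem eval_eulerD_partitionFunction_ne_zero (hG : G.Connected) (hβ0 : 0 ≤ β) (hβ1 : β < 1)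
    {z : ℂ} (hz : 1 ≤ ‖z‖) : (eulerD (partitionFunction G β)).eval z ≠ 0 := by
  rw [eulerD, eval_mul, eval_X]
  by_cases h0 : (partitionFunction G β).eval z = 0
  · refine mul_ne_zero ?_ (eval_derivative_partitionFunction_ne_zero hG hβ0 hβ1 h0)
    rintro rfl; simp at hz; linarith
  · intro h
    -- All zeros have modulus `1 ≤ ‖z‖`, so the logarithmic derivative has real part at least `n / 2
    -- > 0`.
    have hle := le_re_logDeriv h0 fun ζ hζ =>
      (norm_eq_one_of_eval_partitionFunction_eq_zero hβ0 hβ1.le hζ).le.trans hz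
    have hpos : (0 : ℝ) < Fintype.card V :=
      Nat.cast_pos.2 (Fintype.card_pos_iff.2 hG.nonempty)
    rw [h, natDegree_partitionFunction] at hle
    simp at hle
    linarith

end Graph

end Ising

theorem theorem1 {V : Type*} [Fintype V] [DecidableEq V]
    (G : SimpleGraph V) [DecidableRel G.Adj] (hG : G.Connected)
    (β : ℝ) (hβ0 : 0 < β) (hβ1 : β < 1) :
    -- every zero of `D Z_I` lies in the open unit disc
    (∀ z : ℂ, (Ising.eulerD (Ising.partitionFunction G β)).eval z = 0 → ‖z‖ < 1) ∧
    -- every zero of `Z_I` lies on the unit circle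
    (∀ z : ℂ, (Ising.partitionFunction G β).eval z = 0 → ‖z‖ = 1) ∧
    -- `Z_I` and `D Z_I` have no common zeros
    (¬ ∃ z : ℂ, (Ising.partitionFunction G β).eval z = 0 ∧
      (Ising.eulerD (Ising.partitionFunction G β)).eval z = 0) ∧
    -- every zero of `Z_I` is simple
    (∀ z : ℂ, (Ising.partitionFunction G β).eval z = 0 →
      (Ising.partitionFunction G β).rootMultiplicity z = 1) := by
  have hD : ∀ z : ℂ, (Ising.eulerD (Ising.partitionFunction G β)).eval z = 0 → ‖z‖ < 1 :=
    fun z hz => not_le.1 fun h =>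
      Ising.eval_eulerD_partitionFunction_ne_zero hG hβ0.le hβ1 h hz
  have hZ : ∀ z : ℂ, (Ising.partitionFunction G β).eval z = 0 → ‖z‖ = 1 :=
    fun z hz => Ising.norm_eq_one_of_eval_partitionFunction_eq_zero hβ0.le hβ1.le hz
  refine ⟨hD, hZ, fun ⟨z, h1, h2⟩ => (hD z h2).ne (hZ z h1), fun z hz => ?_⟩
  have hne : Ising.partitionFunction G β ≠ 0 := fun h => by
    have := hZ 0 (by simp [h])
    simp at this
  refine le_antisymm (not_lt.1 fun h => ?_) ((rootMultiplicity_pos hne).2 hz)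
  exact Ising.eval_derivative_partitionFunction_ne_zero hG hβ0.le hβ1 hz
    ((one_lt_rootMultiplicity_iff_isRoot hne).1 h).2
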